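/- Let $X$ be a compact Hausdorff space and let $T$ be a topological group acting continuously on the left of $X$ (a compact Hausdorff flow $(X,T)$). A point $x\in X$ is called almost automorphic if for every net $(t_i)_{i\in I}$ in $T$ and every $y\in X$ with $t_i x\to y$ one has $t_i^{-1}y\to x$. Suppose that $(X,T)$ is transitive, i.e. $\overline{Tx}=X$ for some $x\in X$, and that every point of $X$ is almost automorphic. Then $(X,T)$ is minimal, i.e. $\overline{Tx}=X$ for every $x\in X$, and equicontinuous, i.e. for every entourage $\alpha$ of the unique uniform structure compatible with the topology of $X$ there is an entourage $\beta$ such that $(x,y)\in\beta$ implies $(tx,ty)\in\alpha$ for all $t\in T$. -/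

import Mathlib

open Filter Topology

universe u v

/-- A flow `(X, T)` is transitive if some point `x` has orbit closure `X`. -/
def IsTransitiveFlow (T : Type u) (X : Type v) [Group T] [TopologicalSpace X] [MulAction T X] :
    Prop :=
  ∃ x : X, closure (MulAction.orbit T x) = Set.univ

/-- A flow `(X, T)` is equicontinuous if for every entourage `α` there is an entourage `β` such
that `(x, y) ∈ β` implies `(t x, t y) ∈ α` for all `t`. -/
def IsEquicontinuousFlow (T : Type u) (X : Type v) [Group T] [UniformSpace X] [MulAction T X] :
    Prop :=
  UniformEquicontinuous (fun (t : T) (x : X) => t • x)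

/-- A point `x` is almost automorphic if for every net `t i` in `T` with `t i • x → y` for some
`y`, also `(t i)⁻¹ • y → x`. Index sets are taken in the universe of `T`, which is no restriction:
see `isAlmostAutomorphic_iff_filter` and `IsAlmostAutomorphic.tendsto_net`. -/
def IsAlmostAutomorphic (T : Type u) {X : Type v} [Group T] [TopologicalSpace X] [MulAction T X]
    (x : X) : Prop :=
  ∀ (I : Type u) [Preorder I] [IsDirectedOrder I] [Nonempty I] (t : I → T) (y : X),
    Tendsto (fun i => t i • x) atTop (𝓝 y) → Tendsto (fun i => (t i)⁻¹ • y) atTop (𝓝 x)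

/-- The same condition in terms of filters on `T`. -/
theorem isAlmostAutomorphic_iff_filter (T : Type u) {X : Type v} [Group T] [TopologicalSpace X]
    [MulAction T X] (x : X) :
    IsAlmostAutomorphic T x ↔ ∀ (F : Filter T) (y : X),
      Tendsto (fun t => t • x) F (𝓝 y) → Tendsto (fun t => t⁻¹ • y) F (𝓝 x) := by
  constructor
  · intro h F y hF
    rcases F.eq_or_neBot with rfl | hne
    · exact tendsto_bot
    -- the canonical net of a filter: pairs `(S, s)` with `s ∈ S ∈ F`, ordered by reverse inclusion
    let I : Type u := {p : Set T × T // p.1 ∈ F ∧ p.2 ∈ p.1}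
    let _ : Preorder I := Preorder.lift (fun p : I => OrderDual.toDual p.1.1)
    have : IsDirectedOrder I := ⟨fun a b => by
      have hab : a.1.1 ∩ b.1.1 ∈ F := inter_mem a.2.1 b.2.1
      obtain ⟨s, hs⟩ := hne.nonempty_of_mem hab
      exact ⟨⟨(a.1.1 ∩ b.1.1, s), hab, hs⟩, Set.inter_subset_left, Set.inter_subset_right⟩⟩
    have : Nonempty I := by
      obtain ⟨s, hs⟩ := hne.nonempty_of_mem (univ_mem : Set.univ ∈ F)
      exact ⟨⟨(Set.univ, s), univ_mem, hs⟩⟩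
    have hle : Tendsto (fun i : I => i.1.2) atTop F := by
      intro S hS
      obtain ⟨s, hs⟩ := hne.nonempty_of_mem hS
      exact mem_atTop_sets.2 ⟨⟨(S, s), hS, hs⟩, fun b hb => hb b.2.2⟩
    have key := h I (fun i => i.1.2) y (hF.comp hle)
    intro V hV
    by_contra hcon
    obtain ⟨i₀, hi₀⟩ := mem_atTop_sets.1 (key hV)
    apply hcon
    rw [mem_map]
    refine mem_of_superset i₀.2.1 (fun s hs => ?_)
    exact hi₀ ⟨(i₀.1.1, s), i₀.2.1, hs⟩ (le_refl i₀.1.1)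
  · intro h I _ _ _ t y ht
    exact tendsto_map'_iff.1 (h (map t atTop) y (tendsto_map'_iff.2 ht))

/-- The defining property holds for nets indexed in an arbitrary universe. -/
theorem IsAlmostAutomorphic.tendsto_net {T : Type u} {X : Type v} [Group T] [TopologicalSpace X]
    [MulAction T X] {x : X} (hx : IsAlmostAutomorphic T x) {I : Type*} [Preorder I]
    (t : I → T) (y : X) (ht : Tendsto (fun i => t i • x) atTop (𝓝 y)) :
    Tendsto (fun i => (t i)⁻¹ • y) atTop (𝓝 x) :=
  tendsto_map'_iff.1
    ((isAlmostAutomorphic_iff_filter T x).1 hx (map t atTop) y (tendsto_map'_iff.2 ht))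

/-! Almost automorphy makes the enveloping semigroup `E` (the pointwise closure of `T` in `X → X`) a
group: if `(t, t⁻¹) → (p, q)`, then `q` is a two-sided inverse of `p`. So inversion on `E` has a
compact graph and is continuous; it turns right multiplication, always continuous, into left
multiplication. Evaluation at a transitive point is a quotient map from this graph onto `X`, so each
`p ∈ E` is continuous, and inverses in `E` give minimality.

Equicontinuity follows once `{f ∘ t}` is totally bounded in sup norm for each `f ∈ C(X, ℝ)`. A
failure is witnessed by a sequence in `T`, hence in a countable subgroup, where separability and
Baire category apply. -/

/-- The closure, in the product topology on `X → X`, of the translations by elements of `S`. -/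
def translationClosure {T : Type u} (X : Type v) [Group T] [TopologicalSpace X] [MulAction T X]
    (S : Subgroup T) : Set (X → X) :=
  closure ((fun (t : T) (x : X) => t • x) '' S)

/-- The closure in `(X → X) × (X → X)` of the graph of inversion on the translations by
elements of `S`. -/
def inversionGraph {T : Type u} (X : Type v) [Group T] [TopologicalSpace X] [MulAction T X]
    (S : Subgroup T) : Set ((X → X) × (X → X)) :=
  closure ((fun t : T => ((fun x : X => t • x), (fun x : X => t⁻¹ • x))) '' S)

section

variable {T : Type u} {X : Type v} [Group T] [TopologicalSpace X] [MulAction T X]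

theorem smul_mem_translationClosure {S : Subgroup T} {t : T} (ht : t ∈ S) :
    (fun x : X => t • x) ∈ translationClosure X S :=
  subset_closure ⟨t, ht, rfl⟩

theorem translationClosure_mono {S S' : Subgroup T} (h : S ≤ S') :
    translationClosure X S ⊆ translationClosure X S' :=
  closure_mono (Set.image_mono h)

theorem comp_mem_translationClosure [ContinuousConstSMul T X] {S : Subgroup T} {p q : X → X}
    (hp : p ∈ translationClosure X S) (hq : q ∈ translationClosure X S) :
    p ∘ q ∈ translationClosure X S := by
  have key : ∀ t ∈ S, (fun x => t • q x) ∈ translationClosure X S := by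
    intro t ht
    have hc : Continuous (fun (r : X → X) (x : X) => t • r x) := by fun_prop
    refine map_mem_closure hc hq ?_
    rintro _ ⟨s, hs, rfl⟩
    exact ⟨t * s, S.mul_mem ht hs, by ext x; simp [mul_smul]⟩
  have hc : Continuous (fun (r : X → X) => r ∘ q) := by
    refine continuous_pi fun x => continuous_apply (q x)
  have := map_mem_closure hc hp (t := translationClosure X S) (by
    rintro _ ⟨s, hs, rfl⟩
    exact key s hs)
  rwa [translationClosure, closure_closure] at this

theorem inversionGraph_swap {S : Subgroup T} {p q : X → X} (h : (p, q) ∈ inversionGraph X S) :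
    (q, p) ∈ inversionGraph X S := by
  refine map_mem_closure (f := Prod.swap) (s := (_ : Set ((X → X) × (X → X)))) continuous_swap h ?_
  rintro _ ⟨s, hs, rfl⟩
  exact ⟨s⁻¹, S.inv_mem hs, by simp⟩

theorem fst_mem_translationClosure {S : Subgroup T} {p q : X → X}
    (h : (p, q) ∈ inversionGraph X S) : p ∈ translationClosure X S := by
  refine map_mem_closure continuous_fst h ?_
  rintro _ ⟨s, hs, rfl⟩
  exact ⟨s, hs, rfl⟩

theorem snd_mem_translationClosure {S : Subgroup T} {p q : X → X}
    (h : (p, q) ∈ inversionGraph X S) : q ∈ translationClosure X S :=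
  fst_mem_translationClosure (inversionGraph_swap h)

variable [T2Space X]

/-- Along a filter with `t → p` and `t⁻¹ → q` pointwise, `t⁻¹ • p x` tends to `q (p x)`, and to `x`
by almost automorphy. -/
theorem inversionGraph_leftInverse (haa : ∀ x : X, IsAlmostAutomorphic T x) {S : Subgroup T}
    {p q : X → X} (h : (p, q) ∈ inversionGraph X S) : Function.LeftInverse q p := by
  intro x
  set φ : T → (X → X) × (X → X) := fun t => ((fun x => t • x), (fun x => t⁻¹ • x)) with hφ
  have hcl : (p, q) ∈ closure (Set.range φ) :=
    closure_mono (Set.image_subset_range _ _) h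
  have hne : (comap φ (𝓝 (p, q))).NeBot := by
    rw [comap_neBot_iff]
    intro U hU
    obtain ⟨_, hu, t, rfl⟩ := mem_closure_iff_nhds.1 hcl U hU
    exact ⟨t, hu⟩
  have ht : Tendsto φ (comap φ (𝓝 (p, q))) (𝓝 (p, q)) := tendsto_comap
  have h1 : Tendsto (fun t : T => t • x) (comap φ (𝓝 (p, q))) (𝓝 (p x)) :=
    (tendsto_pi_nhds.1 ((continuous_fst.tendsto _).comp ht)) x
  have h2 : Tendsto (fun t : T => t⁻¹ • p x) (comap φ (𝓝 (p, q))) (𝓝 (q (p x))) :=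
    (tendsto_pi_nhds.1 ((continuous_snd.tendsto _).comp ht)) (p x)
  exact tendsto_nhds_unique h2 ((isAlmostAutomorphic_iff_filter T x).1 (haa x) _ _ h1)

theorem inversionGraph_rightInverse (haa : ∀ x : X, IsAlmostAutomorphic T x) {S : Subgroup T}
    {p q : X → X} (h : (p, q) ∈ inversionGraph X S) : Function.RightInverse q p :=
  inversionGraph_leftInverse haa (inversionGraph_swap h)

variable [CompactSpace X]

theorem exists_mem_inversionGraph {S : Subgroup T} {p : X → X}
    (hp : p ∈ translationClosure X S) : ∃ q, (p, q) ∈ inversionGraph X S := by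
  have hcl : IsClosed (Prod.fst '' inversionGraph X S) :=
    (isClosed_closure.isCompact.image continuous_fst).isClosed
  have hsub : translationClosure X S ⊆ Prod.fst '' inversionGraph X S := by
    refine closure_minimal ?_ hcl
    rintro _ ⟨s, hs, rfl⟩
    exact ⟨_, subset_closure ⟨s, hs, rfl⟩, rfl⟩
  obtain ⟨⟨_, q⟩, hq, rfl⟩ := hsub hp
  exact ⟨q, hq⟩

theorem comp_mem_inversionGraph [ContinuousConstSMul T X]
    (haa : ∀ x : X, IsAlmostAutomorphic T x) {S : Subgroup T} {p q r s : X → X}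
    (h : (p, q) ∈ inversionGraph X S) (h' : (r, s) ∈ inversionGraph X S) :
    (p ∘ r, s ∘ q) ∈ inversionGraph X S := by
  -- Composition is not known to be jointly continuous, so the partner of `s ∘ q` is identified by
  -- uniqueness of inverses.
  obtain ⟨w, hw⟩ := exists_mem_inversionGraph (comp_mem_translationClosure
    (snd_mem_translationClosure h') (snd_mem_translationClosure h))
  have : w = p ∘ r := by
    have h1 : Function.LeftInverse w (s ∘ q) := inversionGraph_leftInverse haa hw
    have h2 : Function.RightInverse (p ∘ r) (s ∘ q) :=
      (inversionGraph_leftInverse haa h).comp (inversionGraph_leftInverse haa h')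
    exact h1.eq_rightInverse h2
  subst this
  exact inversionGraph_swap hw

theorem exists_mem_translationClosure_apply_eq {x₀ : X} (hx₀ : closure (MulAction.orbit T x₀) = Set.univ) (x : X) :
    ∃ p ∈ translationClosure X (⊤ : Subgroup T), p x₀ = x := by
  have hcl : IsClosed ((fun p : X → X => p x₀) '' translationClosure X (⊤ : Subgroup T)) :=
    (isClosed_closure.isCompact.image (continuous_apply x₀)).isClosed
  have hsub : closure (MulAction.orbit T x₀) ⊆
      (fun p : X → X => p x₀) '' translationClosure X (⊤ : Subgroup T) := by
    refine closure_minimal ?_ hcl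
    rintro _ ⟨t, rfl⟩
    exact ⟨_, smul_mem_translationClosure (Subgroup.mem_top t), rfl⟩
  rw [hx₀] at hsub
  exact hsub (Set.mem_univ x)

/-- In a transitive flow all of whose points are almost automorphic, the elements of the
enveloping semigroup are continuous. -/
theorem continuous_of_mem_translationClosure [ContinuousConstSMul T X]
    (htrans : IsTransitiveFlow T X) (haa : ∀ x : X, IsAlmostAutomorphic T x)
    {p : X → X} (hp : p ∈ translationClosure X (⊤ : Subgroup T)) : Continuous p := by
  obtain ⟨x₀, hx₀⟩ := htrans
  obtain ⟨q, hpq⟩ := exists_mem_inversionGraph hp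
  let G := inversionGraph X (⊤ : Subgroup T)
  have : CompactSpace G := isCompact_iff_compactSpace.1 isClosed_closure.isCompact
  have hemb : IsClosedEmbedding (fun g : G => g.1.2) := by
    refine Continuous.isClosedEmbedding (by fun_prop) ?_
    rintro ⟨⟨a, b⟩, hab⟩ ⟨⟨a', b'⟩, hab'⟩ (rfl : b = b')
    have : a = a' := (inversionGraph_rightInverse haa hab).leftInverse.eq_rightInverse
      (inversionGraph_leftInverse haa hab')
    subst this
    rfl
  -- Left multiplication by `p`; it covers `p` under evaluation at `x₀`, and in the second
  -- coordinate it is precomposition with `q`.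
  let L : G → G := fun g => ⟨(p ∘ g.1.1, g.1.2 ∘ q), comp_mem_inversionGraph haa hpq g.2⟩
  have hL : Continuous L := by
    rw [hemb.isInducing.continuous_iff]
    exact continuous_pi fun x => (continuous_apply (q x)).comp
      (continuous_snd.comp continuous_subtype_val)
  let e : G → X := fun g => g.1.1 x₀
  have he : Continuous e :=
    (continuous_apply x₀).comp (continuous_fst.comp continuous_subtype_val)
  have hsurj : Function.Surjective e := by
    intro x
    obtain ⟨r, hr, hrx⟩ := exists_mem_translationClosure_apply_eq hx₀ x
    obtain ⟨s, hrs⟩ := exists_mem_inversionGraph hr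
    exact ⟨⟨(r, s), hrs⟩, hrx⟩
  have hquot : IsQuotientMap e := he.isClosedMap.isQuotientMap he hsurj
  rw [hquot.continuous_iff]
  exact he.comp hL

theorem isMinimal_of_isAlmostAutomorphic [ContinuousConstSMul T X]
    (htrans : IsTransitiveFlow T X) (haa : ∀ x : X, IsAlmostAutomorphic T x) :
    MulAction.IsMinimal T X := by
  obtain ⟨x₀, hx₀⟩ := htrans
  refine ⟨fun x => ?_⟩
  obtain ⟨p, hp, rfl⟩ := exists_mem_translationClosure_apply_eq hx₀ x
  obtain ⟨q, hpq⟩ := exists_mem_inversionGraph hp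
  have hmem : x₀ ∈ closure (MulAction.orbit T (p x₀)) := by
    have := map_mem_closure (continuous_apply (p x₀)) (snd_mem_translationClosure hpq)
      (t := MulAction.orbit T (p x₀)) (by rintro _ ⟨t, -, rfl⟩; exact ⟨t, rfl⟩)
    rwa [inversionGraph_leftInverse haa hpq x₀] at this
  rw [dense_iff_closure_eq, ← Set.univ_subset_iff, ← hx₀]
  refine closure_minimal ?_ isClosed_closure
  rintro _ ⟨t, rfl⟩
  refine map_mem_closure (continuous_const_smul t) hmem ?_
  rintro _ ⟨s, rfl⟩
  exact ⟨t * s, mul_smul t s _⟩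

/-! ### Total boundedness of the translates of a function -/

/-- Along a countable group, the translates of a continuous function have finite
`ε`-nets in the uniform norm. -/
theorem exists_finite_approx_of_countable [ContinuousConstSMul T X]
    (haa : ∀ x : X, IsAlmostAutomorphic T x) (S : Subgroup T) [Countable S]
    (hcont : ∀ p ∈ translationClosure X S, Continuous p)
    (f : C(X, ℝ)) {ε : ℝ} (hε : 0 < ε) :
    ∃ N : Set C(X, ℝ), N.Finite ∧ ∀ s ∈ S, ∃ g ∈ N, ∀ x, |f (s • x) - g x| ≤ ε := by
  let K := translationClosure X S
  have : CompactSpace K := isCompact_iff_compactSpace.1 isClosed_closure.isCompact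
  have : Nonempty K := ⟨⟨_, smul_mem_translationClosure S.one_mem⟩⟩
  -- The image of `π` is compact metrizable as `S` is countable, and every `f ∘ p` with `p ∈ K`
  -- factors through it.
  let π : X → S → ℝ := fun x s => f ((s : T) • x)
  have hπ : Continuous π := by fun_prop
  let Y := Set.range π
  have : CompactSpace Y := isCompact_iff_compactSpace.1 (isCompact_range hπ)
  let π' : C(X, Y) := ⟨Set.rangeFactorization π, hπ.subtype_mk _⟩
  have hquot : IsQuotientMap π' :=
    π'.continuous.isClosedMap.isQuotientMap π'.continuous Set.rangeFactorization_surjective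
  have hfiber : ∀ p ∈ K, ∀ a b, π' a = π' b → f (p a) = f (p b) := by
    intro p hp a b hab
    have hcl : IsClosed {r : X → X | f (r a) = f (r b)} :=
      isClosed_eq (by fun_prop) (by fun_prop)
    refine closure_minimal ?_ hcl hp
    rintro _ ⟨s, hs, rfl⟩
    exact congrFun (congrArg Subtype.val hab) ⟨s, hs⟩
  obtain ⟨D, hDc, hDd⟩ := TopologicalSpace.exists_countable_dense C(Y, ℝ)
  have : Countable D := hDc
  let A : D → Set K := fun d => {p | ∀ x, |f (p.1 x) - d.1 (π' x)| ≤ ε}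
  have hA : ∀ d, IsClosed (A d) := by
    intro d
    simp only [A, Set.ofPred_forall]
    refine isClosed_iInter fun x => isClosed_le ?_ continuous_const
    have : Continuous fun p : K => p.1 x := (continuous_apply x).comp continuous_subtype_val
    exact ((f.continuous.comp this).sub continuous_const).abs
  have hAu : ⋃ d, A d = Set.univ := by
    rw [Set.eq_univ_iff_forall]
    intro p
    let h : C(Y, ℝ) := hquot.lift (f.comp ⟨p.1, hcont p.1 p.2⟩) (hfiber p.1 p.2)
    obtain ⟨d, hd, hdist⟩ := hDd.exists_dist_lt h hε
    refine Set.mem_iUnion.2 ⟨⟨d, hd⟩, fun x => ?_⟩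
    have h1 : h (π' x) = f (p.1 x) := by
      have := hquot.lift_comp (f.comp ⟨p.1, hcont p.1 p.2⟩) (hfiber p.1 p.2)
      exact DFunLike.congr_fun this x
    rw [← h1, ← Real.dist_eq]
    exact (ContinuousMap.dist_apply_le_dist _).trans hdist.le
  obtain ⟨d, ⟨p₀, hp₀⟩⟩ := nonempty_interior_of_iUnion_of_closed hA hAu
  let R : K → K → K := fun k p => ⟨p.1 ∘ k.1, comp_mem_translationClosure p.2 k.2⟩
  have hR : ∀ k, Continuous (R k) := fun k =>
    Continuous.subtype_mk (f := fun p : K => p.1 ∘ k.1)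
      (continuous_pi fun x => (continuous_apply (k.1 x)).comp continuous_subtype_val) _
  -- Right translates of the open set given by Baire cover the compact group `K`: `k = p⁻¹ ∘ p₀`
  -- carries `p` to `p₀`.
  obtain ⟨F, hF⟩ := isCompact_univ.elim_finite_subcover (fun k => R k ⁻¹' interior (A d))
    (fun k => isOpen_interior.preimage (hR k)) (by
      intro p _
      obtain ⟨q, hpq⟩ := exists_mem_inversionGraph p.2
      refine Set.mem_iUnion.2 ⟨⟨q ∘ p₀.1,
        comp_mem_translationClosure (snd_mem_translationClosure hpq) p₀.2⟩, ?_⟩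
      have : R ⟨q ∘ p₀.1, comp_mem_translationClosure (snd_mem_translationClosure hpq) p₀.2⟩ p
          = p₀ := Subtype.ext (funext fun x => inversionGraph_rightInverse haa hpq (p₀.1 x))
      rwa [Set.mem_preimage, this])
  choose inv hinv using fun k : K => exists_mem_inversionGraph k.2
  refine ⟨(fun k : K => (d.1.comp π').comp
    ⟨inv k, hcont _ (snd_mem_translationClosure (hinv k))⟩) '' F, F.finite_toSet.image _, ?_⟩
  intro s hs
  obtain ⟨k, hk, hsk⟩ := Set.mem_iUnion₂.1 (hF (Set.mem_univ ⟨_, smul_mem_translationClosure hs⟩))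
  refine ⟨_, ⟨k, hk, rfl⟩, fun x => ?_⟩
  -- Evaluating at `k⁻¹ x` turns the estimate for `f ∘ s ∘ k` into one for `f ∘ s`.
  have := interior_subset hsk (inv k x)
  simpa [R, inversionGraph_rightInverse haa (hinv k) x] using this

theorem exists_finite_approx [ContinuousConstSMul T X]
    (htrans : IsTransitiveFlow T X) (haa : ∀ x : X, IsAlmostAutomorphic T x)
    (f : C(X, ℝ)) {ε : ℝ} (hε : 0 < ε) :
    ∃ N : Set C(X, ℝ), N.Finite ∧ ∀ t : T, ∃ g ∈ N, ∀ x, |f (t • x) - g x| ≤ ε := by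
  by_contra! hcon
  obtain ⟨t, -, ht⟩ := exists_seq_of_forall_finset_exists (fun _ : T => True)
    (fun s t => ∃ x, ε < |f (t • x) - f (s • x)|) (by
      intro F _
      let g : T → C(X, ℝ) := fun s => f.comp ⟨fun x => s • x, continuous_const_smul s⟩
      obtain ⟨t, ht⟩ := hcon (g '' F) (F.finite_toSet.image g)
      exact ⟨t, trivial, fun s hs => ht (g s) ⟨s, hs, rfl⟩⟩)
  let S := (FreeGroup.lift t).range
  have hS : ∀ n, t n ∈ S := fun n => ⟨FreeGroup.of n, FreeGroup.lift_apply_of⟩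
  have : Countable S := (FreeGroup.lift t).rangeRestrict_surjective.countable
  obtain ⟨N, hN, happ⟩ := exists_finite_approx_of_countable haa S (fun p hp =>
    continuous_of_mem_translationClosure htrans haa (translationClosure_mono le_top hp)) f
    (half_pos hε)
  choose g hgN hg using fun n => happ (t n) (hS n)
  have : Finite N := hN
  obtain ⟨m, n, hne, heq⟩ := Finite.exists_ne_map_eq_of_infinite (fun n => (⟨g n, hgN n⟩ : N))
  have heq : g m = g n := congrArg Subtype.val heq
  wlog hlt : m < n generalizing m n
  · exact this n m hne.symm (Subtype.ext heq.symm) heq.symm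
      (lt_of_le_of_ne (not_lt.1 hlt) hne.symm)
  obtain ⟨x, hx⟩ := ht m n hlt
  have h1 := abs_le.1 (hg m x)
  have h2 := abs_le.1 (hg n x)
  rw [heq] at h1
  refine absurd hx (not_lt.2 (abs_le.2 ⟨?_, ?_⟩)) <;> linarith [h1.1, h1.2, h2.1, h2.2]

end

/-! ### Equicontinuity from real-valued functions -/

/-- The evaluation map embeds a compact Hausdorff space uniformly into a power of `ℝ`. -/
theorem isUniformInducing_eval (X : Type v) [UniformSpace X] [CompactSpace X] [T2Space X] :
    IsUniformInducing (fun (x : X) (f : C(X, ℝ)) => f x) := by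
  have hcont : Continuous (fun (x : X) (f : C(X, ℝ)) => f x) := by fun_prop
  have hinj : Function.Injective (fun (x : X) (f : C(X, ℝ)) => f x) := by
    intro x y hxy
    by_contra hne
    obtain ⟨f, h0, h1, -⟩ := exists_continuous_zero_one_of_isClosed
      (isClosed_singleton (x := x)) (isClosed_singleton (x := y)) (by simpa using hne)
    have h : f x = f y := congrFun hxy f
    rw [h0 rfl, h1 rfl] at h
    exact zero_ne_one h
  have hind := (hcont.isClosedEmbedding hinj).isInducing
  rw [isUniformInducing_iff_uniformSpace]
  exact unique_uniformity_of_compact hind.eq_induced.symm rfl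

/-- A family of maps into a product is uniformly equicontinuous if all its coordinates are. -/
theorem uniformEquicontinuous_pi_of_forall {ι κ β α : Type*} [UniformSpace β] [UniformSpace α]
    {F : ι → β → κ → α} (h : ∀ k, UniformEquicontinuous fun i x => F i x k) :
    UniformEquicontinuous F := by
  rw [Pi.uniformSpace_eq, uniformEquicontinuous_iInf_rng]
  rintro k U ⟨V, hV, hVU⟩
  exact (h k V hV).mono fun xy hxy i => hVU (hxy i)

theorem mainTheorem7 {T : Type u} {X : Type v} [Group T] [TopologicalSpace T]
    [IsTopologicalGroup T] [UniformSpace X] [CompactSpace X] [T2Space X]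
    [MulAction T X] [ContinuousSMul T X]
    (htrans : IsTransitiveFlow T X) (haa : ∀ x : X, IsAlmostAutomorphic T x) :
    MulAction.IsMinimal T X ∧ IsEquicontinuousFlow T X := by
  refine ⟨isMinimal_of_isAlmostAutomorphic htrans haa, ?_⟩
  rw [IsEquicontinuousFlow, (isUniformInducing_eval X).uniformEquicontinuous_iff]
  refine uniformEquicontinuous_pi_of_forall fun f => ?_
  rw [Metric.uniformEquicontinuous_iff_right]
  intro ε hε
  obtain ⟨N, hN, happ⟩ := exists_finite_approx htrans haa f (ε := ε / 4) (by positivity)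
  have hev : ∀ᶠ xy in uniformity X, ∀ g ∈ N, dist (g xy.1) (g xy.2) < ε / 4 :=
    (eventually_all_finite hN).2 fun g _ =>
      (CompactSpace.uniformContinuous_of_continuous g.continuous)
        (Metric.dist_mem_uniformity (by positivity))
  filter_upwards [hev] with ⟨x, y⟩ hxy t
  obtain ⟨g, hg, hgt⟩ := happ t
  have h1 := abs_le.1 (hgt x)
  have h2 := abs_le.1 (hgt y)
  have h3 := abs_lt.1 (Real.dist_eq _ _ ▸ hxy g hg)
  change dist (f (t • x)) (f (t • y)) < ε
  rw [Real.dist_eq, abs_lt]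
  constructor <;> linarith [h1.1, h1.2, h2.1, h2.2, h3.1, h3.2]
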